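/- Let $\mathcal L$ be an algebraic signature (finitary operation symbols only) with at least one constant symbol, and let $\mathcal V$ be a variety of $\mathcal L$-algebras. Assume that $\mathcal V$ is a variety of *semilattice-ordered algebras*: there is a binary term that defines a semilattice operation (idempotent, commutative, associative) on every member of $\mathcal V$, taken to be the meet (or, throughout, the join) of the order $\le$ on the members of $\mathcal V$; and for each operation symbol $o$ it is fixed whether $o$ is extended by $o^\sigma$ or by $o^\pi$, as defined next. A *canonical extension* of a poset $P$ is a complete lattice $P^\sigma$ with an order embedding $P\subseteq P^\sigma$ preserving all existing finite meets and joins such that, calling meets (joins) in $P^\sigma$ of non-empty subsets of $P$ *closed* (*open*) and writing $K$ ($O$) for the set of closed (open) elements, (density) every element of $P^\sigma$ is a join of closed elements and a meet of open elements, and (compactness) for non-empty $A\subseteq K$, $B\subseteq O$ with $\bigwedge A\le\bigvee B$ there are finite $A_0\subseteq A$, $B_0\subseteq B$ with $\bigwedge A_0\le\bigvee B_0$. For $f\colon P^n\to P$ and $x\in (P^\sigma)^n$, with coordinatewise order, $$f^\sigma(x)=\bigvee\Big\{\bigwedge\{f(a)\mid a\in P^n,\ p\le a\le q\}\ \Big|\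 p\in K^n,\ q\in O^n,\ p\le x\le q\Big\},$$ $$f^\pi(x)=\bigwedge\Big\{\bigvee\{f(a)\mid a\in P^n,\ p\le a\le q\}\ \Big|\ p\in K^n,\ q\in O^n,\ p\le x\le q\Big\}.$$ For each $\mathbf A\in\mathcal V$ fix a canonical extension of its poset reduct (one exists; the choice is arbitrary), and let $\mathbf A^\sigma$ be this ordered set equipped with the extensions $o^\sigma$ or $o^\pi$, as prescribed, of the operations of $\mathbf A$. Assume that $\mathcal V$ is *closed under canonical extensions*: for every $\mathbf A\in\mathcal V$, $\mathbf A^\sigma$ with the order of the canonical extension is a semilattice-ordered algebra of $\mathcal V$, i.e. the algebra $\mathbf A^\sigma$ belongs to $\mathcal V$ and its term-defined order is the order of the canonical extension. Assume also that $\mathcal V$ is *coherent*: every finitely generated subalgebra of a finitely presented member of $\mathcal V$ is finitely presented (in $\mathcal V$). Let $t(x)$ be a unary $\mathcal L$-term that is - $\mathcal V$-*expanding*: $t^{\mathbf A^\sigma}(x)\ge (t^{\mathbf A})^\sigma(x)$ for all $\mathbf A\in\mathcal V$ and all $x\in\mathbf A^\sigma$; - *order-preserving* in $\mathcal V$: $\mathcal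 V\models x\le y\Rightarrow t(x)\le t(y)$; - *decreasing* in $\mathcal V$: $\mathcal V\models t(x)\le x$. Then $t$ is $n$-potent in $\mathcal V$ for some $n\in\mathbb N$, i.e. $\mathcal V\models t^{n+1}(x)\approx t^n(x)$, where $t^0(x)=x$ and $t^{k+1}(x)=t(t^k(x))$. -/

import Mathlib

universe u v

namespace CanonExt

open scoped FirstOrder

/-! ### Canonical extensions of posets and of maps -/

section Posets

variable {P C : Type u} [CompleteLattice C]

/-- `c` is closed: a meet, in `C`, of a non-empty set of elements of `P`. -/
def IsClosedElt (e : P → C) (c : C) : Prop :=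
  ∃ X : Set P, X.Nonempty ∧ c = sInf (e '' X)

/-- `c` is open: a join, in `C`, of a non-empty set of elements of `P`. -/
def IsOpenElt (e : P → C) (c : C) : Prop :=
  ∃ X : Set P, X.Nonempty ∧ c = sSup (e '' X)

/-- `e : P → C` is a dense and compact completion of the poset `P`. -/
structure IsCanonicalExtension [PartialOrder P] (e : P → C) : Prop where
  /-- `e` is an order embedding -/
  le_iff : ∀ a b : P, e a ≤ e b ↔ a ≤ b
  /-- `e` preserves all existing finite meets -/
  map_isGLB : ∀ (X : Set P) (a : P), X.Finite → IsGLB X a → IsGLB (e '' X) (e a)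
  /-- `e` preserves all existing finite joins -/
  map_isLUB : ∀ (X : Set P) (a : P), X.Finite → IsLUB X a → IsLUB (e '' X) (e a)
  /-- density: every element is a join of closed elements -/
  eq_sSup_closed : ∀ c : C, ∃ S : Set C, (∀ k ∈ S, IsClosedElt e k) ∧ c = sSup S
  /-- density: every element is a meet of open elements -/
  eq_sInf_open : ∀ c : C, ∃ S : Set C, (∀ o ∈ S, IsOpenElt e o) ∧ c = sInf S
  /-- compactness (the converse implication is automatic) -/
  compact : ∀ A B : Set C, A.Nonempty → B.Nonempty →
    (∀ k ∈ A, IsClosedElt e k) → (∀ o ∈ B, IsOpenElt e o) → sInf A ≤ sSup B →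
    ∃ A₀ ⊆ A, ∃ B₀ ⊆ B, A₀.Finite ∧ B₀.Finite ∧ sInf A₀ ≤ sSup B₀

/-- The `σ`-extension of a map `f : P^ι → P`, where the closed and open elements of
`(P^ι)^σ = (P^σ)^ι` are computed coordinatewise. The formula only depends on intervals, so it is
unchanged when some of the coordinates of the domain are dualised. -/
def sigmaExt {ι : Type*} (e : P → C) (f : (ι → P) → P) (x : ι → C) : C :=
  sSup {c | ∃ p q : ι → C, (∀ i, IsClosedElt e (p i)) ∧ (∀ i, IsOpenElt e (q i)) ∧
    p ≤ x ∧ x ≤ q ∧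
    c = sInf {d | ∃ a : ι → P, (∀ i, p i ≤ e (a i) ∧ e (a i) ≤ q i) ∧ d = e (f a)}}

/-- The `π`-extension of a map `f : P^ι → P`. -/
def piExt {ι : Type*} (e : P → C) (f : (ι → P) → P) (x : ι → C) : C :=
  sInf {c | ∃ p q : ι → C, (∀ i, IsClosedElt e (p i)) ∧ (∀ i, IsOpenElt e (q i)) ∧
    p ≤ x ∧ x ≤ q ∧
    c = sSup {d | ∃ a : ι → P, (∀ i, p i ≤ e (a i) ∧ e (a i) ≤ q i) ∧ d = e (f a)}}

end Posets

/-- A canonical extension of the poset `P`: a complete lattice together with a dense and compact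
embedding of `P` into it. -/
structure CanonicalExtension (P : Type u) [PartialOrder P] : Type (u + 1) where
  carrier : Type u
  [lattice : CompleteLattice carrier]
  emb : P → carrier
  isCanonicalExtension : IsCanonicalExtension emb

attribute [instance] CanonicalExtension.lattice

section Existence

variable {P : Type u} [PartialOrder P]

/-- Non-empty upper sets closed under the existing finite meets. -/
def IsFilt (F : Set P) : Prop :=
  F.Nonempty ∧ IsUpperSet F ∧ ∀ (X : Set P) (a : P), X.Finite → X ⊆ F → IsGLB X a → a ∈ F

/-- Non-empty lower sets closed under the existing finite joins. -/
def IsIdl (I : Set P) : Prop :=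
  I.Nonempty ∧ IsLowerSet I ∧ ∀ (X : Set P) (a : P), X.Finite → X ⊆ I → IsLUB X a → a ∈ I

/-- A filter and an ideal are related if they meet. -/
def Meets (F : {F : Set P // IsFilt F}) (I : {I : Set P // IsIdl I}) : Prop :=
  (F.1 ∩ I.1).Nonempty

theorem isFilt_Ici (a : P) : IsFilt (Set.Ici a) :=
  ⟨⟨a, le_refl a⟩, isUpperSet_Ici a, fun _ _ _ hX hb => hb.2 fun _ hx => hX hx⟩

theorem isIdl_Iic (a : P) : IsIdl (Set.Iic a) :=
  ⟨⟨a, le_refl a⟩, isLowerSet_Iic a, fun _ _ _ hX hb => hb.2 fun _ hx => hX hx⟩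

theorem isFilt_gen {X : Set P} (hX : X.Nonempty) :
    IsFilt {a | ∃ Y ⊆ X, Y.Finite ∧ ∀ F, IsFilt F → Y ⊆ F → a ∈ F} := by
  refine ⟨?_, ?_, ?_⟩
  · obtain ⟨x, hx⟩ := hX
    exact ⟨x, {x}, by simpa using hx, Set.finite_singleton x, fun F _ h => h rfl⟩
  · rintro a b hab ⟨Y, hY, hf, h⟩
    exact ⟨Y, hY, hf, fun F hF hYF => hF.2.1 hab (h F hF hYF)⟩
  · intro Z a hZ hsub ha
    have hsub' : ∀ z ∈ Z, ∃ Y ⊆ X, Y.Finite ∧ ∀ F, IsFilt F → Y ⊆ F → z ∈ F := fun z hz => hsub hz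
    choose! Y hY hf h using hsub'
    refine ⟨⋃ z ∈ Z, Y z, Set.iUnion₂_subset fun z hz => hY z hz, hZ.biUnion fun z hz => hf z hz, ?_⟩
    intro F hF hYF
    refine hF.2.2 Z a hZ (fun z hz => h z hz F hF ?_) ha
    exact (Set.subset_biUnion_of_mem (u := Y) hz).trans hYF

theorem isIdl_gen {X : Set P} (hX : X.Nonempty) :
    IsIdl {a | ∃ Y ⊆ X, Y.Finite ∧ ∀ F, IsIdl F → Y ⊆ F → a ∈ F} := by
  refine ⟨?_, ?_, ?_⟩
  · obtain ⟨x, hx⟩ := hX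
    exact ⟨x, {x}, by simpa using hx, Set.finite_singleton x, fun F _ h => h rfl⟩
  · rintro a b hab ⟨Y, hY, hf, h⟩
    exact ⟨Y, hY, hf, fun F hF hYF => hF.2.1 hab (h F hF hYF)⟩
  · intro Z a hZ hsub ha
    have hsub' : ∀ z ∈ Z, ∃ Y ⊆ X, Y.Finite ∧ ∀ F, IsIdl F → Y ⊆ F → z ∈ F := fun z hz => hsub hz
    choose! Y hY hf h using hsub'
    refine ⟨⋃ z ∈ Z, Y z, Set.iUnion₂_subset fun z hz => hY z hz, hZ.biUnion fun z hz => hf z hz, ?_⟩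
    intro F hF hYF
    refine hF.2.2 Z a hZ (fun z hz => h z hz F hF ?_) ha
    exact (Set.subset_biUnion_of_mem (u := Y) hz).trans hYF

/-- The image of `a : P` in the concept lattice of `Meets`. -/
def conceptEmb (a : P) : Concept {F : Set P // IsFilt F} {I : Set P // IsIdl I} Meets where
  extent := {F | a ∈ F.1}
  intent := {I | a ∈ I.1}
  upperPolar_extent := by
    ext I
    constructor
    · intro h
      obtain ⟨b, hb, hbI⟩ := h (a := ⟨Set.Ici a, isFilt_Ici a⟩) (le_refl a)
      exact I.2.2.1 hb hbI
    · exact fun h F hF => ⟨a, hF, h⟩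
  lowerPolar_intent := by
    ext F
    constructor
    · intro h
      obtain ⟨b, hbF, hb⟩ := h (b := ⟨Set.Iic a, isIdl_Iic a⟩) (le_refl a)
      exact F.2.2.1 hb hbF
    · exact fun h I hI => ⟨a, h, hI⟩

theorem mem_extent_sInf_emb (X : Set P) (F : {F : Set P // IsFilt F}) :
    F ∈ (sInf (conceptEmb '' X)).extent ↔ X ⊆ F.1 := by
  rw [sInf_image']
  simp only [Concept.extent_iInf, Set.mem_iInter]
  exact ⟨fun h x hx => h ⟨x, hx⟩, fun h x => h x.2⟩

theorem mem_intent_sSup_emb (X : Set P) (I : {I : Set P // IsIdl I}) :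
    I ∈ (sSup (conceptEmb '' X)).intent ↔ X ⊆ I.1 := by
  rw [sSup_image']
  simp only [Concept.intent_iSup, Set.mem_iInter]
  exact ⟨fun h x hx => h ⟨x, hx⟩, fun h x => h x.2⟩

theorem isCanonicalExtension_conceptEmb : IsCanonicalExtension (conceptEmb (P := P)) where
  le_iff a b := by
    rw [← Concept.extent_subset_extent_iff]
    constructor
    · intro h
      exact h (a := ⟨Set.Ici a, isFilt_Ici a⟩) (le_refl a)
    · exact fun h F hF => F.2.2.1 h hF
  map_isGLB X a hX ha := by
    constructor
    · rintro _ ⟨x, hx, rfl⟩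
      rw [← Concept.extent_subset_extent_iff]
      exact fun F hF => F.2.2.1 (ha.1 hx) hF
    · intro c hc
      rw [← Concept.extent_subset_extent_iff]
      intro F hF
      exact F.2.2.2 X a hX (fun x hx =>
        (Concept.extent_subset_extent_iff.2 (hc (Set.mem_image_of_mem _ hx))) hF) ha
  map_isLUB X a hX ha := by
    constructor
    · rintro _ ⟨x, hx, rfl⟩
      rw [← Concept.intent_subset_intent_iff]
      exact fun F hF => F.2.2.1 (ha.1 hx) hF
    · intro c hc
      rw [← Concept.intent_subset_intent_iff]
      intro F hF
      exact F.2.2.2 X a hX (fun x hx =>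
        (Concept.intent_subset_intent_iff.2 (hc (Set.mem_image_of_mem _ hx))) hF) ha
  eq_sSup_closed c := by
    refine ⟨(fun F => sInf (conceptEmb '' F.1)) '' c.extent, ?_, le_antisymm ?_ ?_⟩
    · rintro _ ⟨F, _, rfl⟩
      exact ⟨F.1, F.2.1, rfl⟩
    · rw [← Concept.extent_subset_extent_iff]
      intro F hF
      have h := le_sSup (Set.mem_image_of_mem (fun F => sInf (conceptEmb '' F.1)) hF)
      exact (Concept.extent_subset_extent_iff.2 h)
        ((mem_extent_sInf_emb F.1 F).2 subset_rfl)
    · refine sSup_le ?_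
      rintro _ ⟨F, hF, rfl⟩
      rw [← Concept.extent_subset_extent_iff]
      intro G hG
      rw [mem_extent_sInf_emb] at hG
      rw [← c.lowerPolar_intent] at hF ⊢
      exact fun I hI => (hF hI).mono (Set.inter_subset_inter_left _ hG)
  eq_sInf_open c := by
    refine ⟨(fun F => sSup (conceptEmb '' F.1)) '' c.intent, ?_, le_antisymm ?_ ?_⟩
    · rintro _ ⟨F, _, rfl⟩
      exact ⟨F.1, F.2.1, rfl⟩
    · refine le_sInf ?_
      rintro _ ⟨F, hF, rfl⟩
      rw [← Concept.intent_subset_intent_iff]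
      intro G hG
      rw [mem_intent_sSup_emb] at hG
      rw [← c.upperPolar_extent] at hF ⊢
      exact fun I hI => (hF hI).mono (Set.inter_subset_inter_right _ hG)
    · rw [← Concept.intent_subset_intent_iff]
      intro F hF
      have h := sInf_le (Set.mem_image_of_mem (fun F => sSup (conceptEmb '' F.1)) hF)
      exact (Concept.intent_subset_intent_iff.2 h)
        ((mem_intent_sSup_emb F.1 F).2 subset_rfl)
  compact A B hA hB hAc hBo hle := by
    choose! X hXne hX using hAc
    choose! Y hYne hY using hBo
    have hXU : (⋃ k ∈ A, X k).Nonempty := by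
      obtain ⟨k, hk⟩ := hA
      obtain ⟨x, hx⟩ := hXne k hk
      exact ⟨x, Set.mem_biUnion hk hx⟩
    have hYU : (⋃ k ∈ B, Y k).Nonempty := by
      obtain ⟨k, hk⟩ := hB
      obtain ⟨x, hx⟩ := hYne k hk
      exact ⟨x, Set.mem_biUnion hk hx⟩
    have hG : (⟨_, isFilt_gen hXU⟩ : {F : Set P // IsFilt F}) ∈ (sInf A).extent := by
      rw [sInf_eq_iInf', Concept.extent_iInf, Set.mem_iInter]
      rintro ⟨k, hk⟩
      change _ ∈ k.extent
      rw [hX k hk, mem_extent_sInf_emb]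
      intro x hx
      exact ⟨{x}, by simpa using ⟨k, hk, hx⟩, Set.finite_singleton x, fun F _ h => h rfl⟩
    have hJ : (⟨_, isIdl_gen hYU⟩ : {F : Set P // IsIdl F}) ∈ (sSup B).intent := by
      rw [sSup_eq_iSup', Concept.intent_iSup, Set.mem_iInter]
      rintro ⟨k, hk⟩
      change _ ∈ k.intent
      rw [hY k hk, mem_intent_sSup_emb]
      intro x hx
      exact ⟨{x}, by simpa using ⟨k, hk, hx⟩, Set.finite_singleton x, fun F _ h => h rfl⟩
    obtain ⟨a, ⟨X₀, hX₀, hX₀f, haX⟩, ⟨Y₀, hY₀, hY₀f, haY⟩⟩ :=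
      Concept.rel_extent_intent (Concept.extent_subset_extent_iff.2 hle hG) hJ
    have h1 : ∀ x ∈ X₀, ∃ k ∈ A, x ∈ X k := fun x hx => by simpa using hX₀ hx
    have h2 : ∀ x ∈ Y₀, ∃ k ∈ B, x ∈ Y k := fun x hx => by simpa using hY₀ hx
    choose! k hk hxk using h1
    choose! l hl hyl using h2
    refine ⟨k '' X₀, Set.image_subset_iff.2 hk, l '' Y₀, Set.image_subset_iff.2 hl,
      hX₀f.image _, hY₀f.image _, le_trans (b := conceptEmb a) ?_ ?_⟩
    · rw [← Concept.extent_subset_extent_iff]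
      intro F hF
      refine haX F.1 F.2 fun x hx => ?_
      have h := Concept.extent_subset_extent_iff.2 (sInf_le (Set.mem_image_of_mem k hx)) hF
      rw [hX _ (hk x hx), mem_extent_sInf_emb] at h
      exact h (hxk x hx)
    · rw [← Concept.intent_subset_intent_iff]
      intro F hF
      refine haY F.1 F.2 fun x hx => ?_
      have h := Concept.intent_subset_intent_iff.2 (le_sSup (Set.mem_image_of_mem l hx)) hF
      rw [hY _ (hl x hx), mem_intent_sSup_emb] at h
      exact h (hyl x hx)

/-- Every poset has a canonical extension. -/
theorem nonempty_canonicalExtension (P : Type u) [PartialOrder P] :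
    Nonempty (CanonicalExtension P) :=
  ⟨⟨_, conceptEmb, isCanonicalExtension_conceptEmb⟩⟩

end Existence

/-! ### Varieties, finite presentations and coherence -/

/-- A variety of `L`-algebras, given by a set of identities. -/
structure Variety (L : FirstOrder.Language.{u, v}) where
  identities : Set (L.Term ℕ × L.Term ℕ)

namespace Variety

variable {L : FirstOrder.Language.{u, v}} (V : Variety L)

/-- The algebra `A` belongs to the variety `V`. -/
def Mem (A : Type u) [L.Structure A] : Prop :=
  ∀ p ∈ V.identities, ∀ x : ℕ → A, p.1.realize x = p.2.realize x

/-- `V ⊨ s ≈ t`. -/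
def Valid {α : Type} (s t : L.Term α) : Prop :=
  ∀ (A : Type u) [L.Structure A], V.Mem A → ∀ x : α → A, s.realize x = t.realize x

/-- `A` is a finitely presented member of `V`: it is generated by a tuple `g` that satisfies a
finite set `R` of relations and is universal for this among the members of `V`. -/
def IsFinitelyPresented (A : Type u) [L.Structure A] : Prop :=
  V.Mem A ∧ ∃ (n : ℕ) (R : Set (L.Term (Fin n) × L.Term (Fin n))) (g : Fin n → A),
    R.Finite ∧ FirstOrder.Language.Substructure.closure L (Set.range g) = ⊤ ∧
    (∀ r ∈ R, r.1.realize g = r.2.realize g) ∧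
    ∀ (B : Type u) [L.Structure B], V.Mem B → ∀ h : Fin n → B,
      (∀ r ∈ R, r.1.realize h = r.2.realize h) → ∃ φ : A →[L] B, ∀ i, φ (g i) = h i

/-- Every finitely generated subalgebra of a finitely presented member of `V` is finitely
presented. -/
def Coherent : Prop :=
  ∀ (A : Type u) [L.Structure A], V.IsFinitelyPresented A →
    ∀ S : L.Substructure A, S.FG → V.IsFinitelyPresented S

end Variety

/-! ### Semilattice-ordered algebras -/

/-- Whether the semilattice operation is the meet or the join of the order. -/
inductive SemilatticeKind
  | meet
  | join

/-- Whether an operation is extended by its `σ`- or by its `π`-extension. -/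
inductive ExtensionKind
  | sigma
  | pi

/-- A variety of semilattice-ordered algebras: its members have a uniformly term-definable
semilattice reduct, and for every operation symbol it is determined which of its two canonical
extensions is taken. -/
structure SemilatticeOrderedVariety (L : FirstOrder.Language.{u, v}) extends Variety L where
  kind : SemilatticeKind
  /-- the binary term defining the semilattice operation -/
  op : L.Term (Fin 2)
  op_idem : ∀ (A : Type u) [L.Structure A], toVariety.Mem A →
    ∀ x : A, op.realize ![x, x] = x
  op_comm : ∀ (A : Type u) [L.Structure A], toVariety.Mem A →
    ∀ x y : A, op.realize ![x, y] = op.realize ![y, x]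
  op_assoc : ∀ (A : Type u) [L.Structure A], toVariety.Mem A →
    ∀ x y z : A, op.realize ![op.realize ![x, y], z] = op.realize ![x, op.realize ![y, z] ]
  extKind : ∀ {n : ℕ}, L.Functions n → ExtensionKind

namespace SemilatticeOrderedVariety

variable {L : FirstOrder.Language.{u, v}} (V : SemilatticeOrderedVariety L)

/-- The term-defined order of an algebra: `x ∧ y = x`, respectively `x ∨ y = y`. -/
def le {A : Type u} [L.Structure A] (x y : A) : Prop :=
  match V.kind with
  | .meet => V.op.realize ![x, y] = x
  | .join => V.op.realize ![x, y] = y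

/-- The poset reduct of a member of `V`. -/
@[reducible] def partialOrder {A : Type u} [L.Structure A] (hA : V.Mem A) : PartialOrder A where
  le := V.le
  le_refl x := by
    unfold le
    cases V.kind <;> exact V.op_idem A hA x
  le_trans x y z := by
    unfold le
    cases V.kind <;> intro hxy hyz
    · change _ = _
      rw [← hxy, V.op_assoc A hA, hyz]
    · change _ = _
      rw [← hyz, ← V.op_assoc A hA, hxy]
  le_antisymm x y := by
    unfold le
    cases V.kind <;> intro hxy hyx
    · exact hxy.symm.trans ((V.op_comm A hA x y).trans hyx)
    · exact hyx.symm.trans ((V.op_comm A hA y x).trans hxy)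

/-- A choice, for every member `A` of `V`, of a canonical extension of its poset reduct. -/
def CanonicalExtensions : Type (max (u + 1) v) :=
  ∀ (A : Type u) [L.Structure A] (hA : V.Mem A), @CanonicalExtension A (V.partialOrder hA)

theorem nonempty_canonicalExtensions : Nonempty V.CanonicalExtensions :=
  ⟨fun A _ hA => Classical.choice (@nonempty_canonicalExtension A (V.partialOrder hA))⟩

variable {V}

namespace CanonicalExtensions

variable (E : V.CanonicalExtensions) {A : Type u} [L.Structure A] (hA : V.Mem A)

/-- The universe of `A^σ`. -/
def Ext : Type u := @CanonicalExtension.carrier A (V.partialOrder hA) (E A hA)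

instance : CompleteLattice (E.Ext hA) :=
  @CanonicalExtension.lattice A (V.partialOrder hA) (E A hA)

/-- The embedding of `A` into `A^σ`. -/
def emb : A → E.Ext hA := @CanonicalExtension.emb A (V.partialOrder hA) (E A hA)

/-- The algebra `A^σ`: the canonical extension of the poset reduct of `A`, equipped with the
canonical extensions, of the kinds determined by `V`, of the operations of `A`. -/
instance [L.IsAlgebraic] : L.Structure (E.Ext hA) where
  funMap f x :=
    match V.extKind f with
    | .sigma => sigmaExt (E.emb hA) (fun a => FirstOrder.Language.Structure.funMap f a) x
    | .pi => piExt (E.emb hA) (fun a => FirstOrder.Language.Structure.funMap f a) x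
  RelMap r _ := isEmptyElim r

end CanonicalExtensions

variable (V)

/-- `V` is closed under canonical extensions: for all `A` in `V`, the ordered algebra `A^σ` is
a semilattice-ordered algebra in `V`, that is, the algebra belongs to `V` and its term-defined
order is the order of the canonical extension. -/
def ClosedUnderCanonicalExtensions [L.IsAlgebraic] (E : V.CanonicalExtensions) : Prop :=
  ∀ (A : Type u) [L.Structure A] (hA : V.Mem A),
    V.Mem (E.Ext hA) ∧ ∀ x y : E.Ext hA, V.le x y ↔ x ≤ y

/-- The unary term `t` is `V`-expanding: the term operation of `A^σ` lies pointwise above the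
`σ`-extension of the term operation of `A`. -/
def IsExpanding [L.IsAlgebraic] (E : V.CanonicalExtensions) (t : L.Term (Fin 1)) : Prop :=
  ∀ (A : Type u) [L.Structure A] (hA : V.Mem A), ∀ x : Fin 1 → E.Ext hA,
    sigmaExt (E.emb hA) (fun a : Fin 1 → A => t.realize a) x ≤ t.realize x

/-- `V ⊨ x ≤ y ⇒ t(x) ≤ t(y)`. -/
def IsOrderPreserving (t : L.Term (Fin 1)) : Prop :=
  ∀ (A : Type u) [L.Structure A], V.Mem A → ∀ x y : A, V.le x y →
    V.le (t.realize fun _ => x) (t.realize fun _ => y)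

/-- `V ⊨ t(x) ≤ x`. -/
def IsDecreasing (t : L.Term (Fin 1)) : Prop :=
  ∀ (A : Type u) [L.Structure A], V.Mem A → ∀ x : A, V.le (t.realize fun _ => x) x

end SemilatticeOrderedVariety

/-- The iterated term `t^k`: `t^0(x) = x` and `t^{k+1}(x) = t(t^k(x))`. -/
def iterTerm {L : FirstOrder.Language.{u, v}} (t : L.Term (Fin 1)) : ℕ → L.Term (Fin 1)
  | 0 => FirstOrder.Language.Term.var 0
  | k + 1 => t.subst fun _ => iterTerm t k

/-- `V ⊨ t^{n+1}(x) ≈ t^n(x)`. -/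
def Variety.IsPotent {L : FirstOrder.Language.{u, v}} (V : Variety L) (n : ℕ) (t : L.Term (Fin 1)) : Prop :=
  V.Valid (iterTerm t (n + 1)) (iterTerm t n)

end CanonExt

/-!
A decreasing term is `n`-potent as soon as the condition "`z ≤ tᵏ(x)` for all `k`" is implied by
finitely many of its instances: if `z ≤ tᴺ(x)` implies `z ≤ tᴺ⁺¹(x)` throughout the variety, take
`z = tᴺ(x)`. Coherence supplies this compactness.

Let `P` be the algebra presented by `⟨x, y, z ∣ z ≤ y ≤ x, t(y) ≈ y⟩`, and `S` its subalgebra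
generated by `x` and `z`. Since `t` is monotone, `z ≤ tᵏ(x)` holds in `S` for all `k`. Coherence
gives a finite presentation of `S`. Let `Q` be the algebra presented by `⟨x, z ∣ z ≤ tᵏ(x), k ∈ ℕ⟩`.
In `Q^σ` the meet `m` of all `tᵏ(x)` is a fixpoint of `t`: it is closed, by compactness every element
of `Q` above it lies above some `tᵏ(x)`, and therefore `m ≤ t^σ(m) ≤ t(m) ≤ m`
(`realize_sInf_iterate`). As `Q` embeds in `Q^σ` (`embHom`), there is a homomorphism from `P` to
`Q^σ` that sends `x, z` to `x, z` and `y` to `m`, so every equation between `x` and `z` that holds in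
`S` holds in `Q` (`mk_eq_of_entails`). Hence the finitely many defining relations of `S` hold in `Q`,
and, each of them needing only finitely many of the relations of `Q`, they follow from
`z ≤ tᴺ(x)` for a single `N`. Then so does `z ≤ tᴺ⁺¹(x)`.
-/

namespace CanonExt

open FirstOrder.Language FirstOrder.Language.Structure
open scoped FirstOrder

/-! ### Algebras presented by generators and relations -/

section Presentation

variable {L : FirstOrder.Language.{u, v}}

theorem mem_closure_range_iff {A : Type u} [L.Structure A] {ι : Type} (g : ι → A) (a : A) :
    a ∈ Substructure.closure L (Set.range g) ↔ ∃ s : L.Term ι, s.realize g = a := by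
  constructor
  · intro h
    rw [Substructure.mem_closure_iff_exists_term] at h
    obtain ⟨s, rfl⟩ := h
    refine ⟨s.relabel fun b => b.2.choose, ?_⟩
    rw [Term.realize_relabel]
    congr 1
    funext b
    exact b.2.choose_spec
  · rintro ⟨s, rfl⟩
    exact s.realize_mem _ fun i => Substructure.subset_closure ⟨i, rfl⟩

/-- The assignment `h` satisfies all the equations in `Γ`. -/
def Satisfies {A : Type u} [L.Structure A] {α : Type} (h : α → A)
    (Γ : Set (L.Term α × L.Term α)) : Prop :=
  ∀ r ∈ Γ, r.1.realize h = r.2.realize h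

namespace Variety

variable (V : Variety L) {α : Type}

/-- `s ≈ s'` is a consequence, in `V`, of the equations in `Γ`. -/
def Entails (Γ : Set (L.Term α × L.Term α)) (s s' : L.Term α) : Prop :=
  ∀ (A : Type u) [L.Structure A], V.Mem A → ∀ h : α → A, Satisfies h Γ →
    s.realize h = s'.realize h

theorem Entails.mono {V : Variety L} {Γ Δ : Set (L.Term α × L.Term α)} {s s' : L.Term α}
    (h : V.Entails Γ s s') (hs : Γ ⊆ Δ) : V.Entails Δ s s' :=
  fun A _ hA a ha => h A hA a fun r hr => ha r (hs hr)

/-- The congruence generated, relative to `V`, by the equations in `Γ`. It is defined as semantic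
consequence of a finite part of `Γ`, so that compactness of equational logic is built in. -/
def congruence (Γ : Set (L.Term α × L.Term α)) : Setoid (L.Term α) where
  r s s' := ∃ Δ ⊆ Γ, Δ.Finite ∧ V.Entails Δ s s'
  iseqv :=
    { refl := fun _ => ⟨∅, Set.empty_subset _, Set.finite_empty, fun _ _ _ _ _ => rfl⟩
      symm := fun ⟨Δ, hs, hf, h⟩ => ⟨Δ, hs, hf, fun A _ hA a ha => (h A hA a ha).symm⟩
      trans := fun ⟨Δ, hs, hf, h⟩ ⟨Δ', hs', hf', h'⟩ =>
        ⟨Δ ∪ Δ', Set.union_subset hs hs', hf.union hf', fun A _ hA a ha =>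
          (h.mono Set.subset_union_left A hA a ha).trans
            (h'.mono Set.subset_union_right A hA a ha)⟩ }

/-- The algebra presented, in `V`, by the generators `α` and the relations `Γ`. -/
def Presented (Γ : Set (L.Term α × L.Term α)) : Type u :=
  Quotient (V.congruence Γ)

namespace Presented

variable {V} (Γ : Set (L.Term α × L.Term α))

/-- The element of the presented algebra denoted by a term. -/
def mk (s : L.Term α) : V.Presented Γ :=
  Quotient.mk (V.congruence Γ) s

variable {Γ}

theorem mk_eq_iff {s s' : L.Term α} :
    (mk Γ s : V.Presented Γ) = mk Γ s' ↔ ∃ Δ ⊆ Γ, Δ.Finite ∧ V.Entails Δ s s' :=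
  Quotient.eq (r := V.congruence Γ)

theorem exists_mk (x : V.Presented Γ) : ∃ s, mk Γ s = x :=
  Quotient.exists_rep x

theorem mk_func {n : ℕ} (f : L.Functions n) {s s' : Fin n → L.Term α}
    (h : ∀ i, (mk Γ (s i) : V.Presented Γ) = mk Γ (s' i)) :
    (mk Γ (Term.func f s) : V.Presented Γ) = mk Γ (Term.func f s') := by
  simp only [mk_eq_iff] at h ⊢
  choose Δ hs hf h using h
  refine ⟨⋃ i, Δ i, Set.iUnion_subset hs, Set.finite_iUnion hf, fun A _ hA a ha => ?_⟩
  simp only [Term.realize_func]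
  congr 1
  funext i
  exact (h i).mono (Set.subset_iUnion Δ i) A hA a ha

variable [L.IsAlgebraic]

/-- The operations are computed on chosen representing terms; by `mk_func` the choice is
irrelevant. -/
noncomputable instance : L.Structure (V.Presented Γ) where
  funMap f x := mk Γ (Term.func f fun i => (exists_mk (x i)).choose)
  RelMap r _ := isEmptyElim r

theorem realize_mk {β : Type} (s : L.Term β) (w : β → L.Term α) :
    s.realize (fun i => (mk Γ (w i) : V.Presented Γ)) = mk Γ (s.subst w) := by
  induction s with
  | var i => rfl
  | func f ts ih =>
    rw [Term.realize_func]
    exact mk_func f fun i => (exists_mk _).choose_spec.trans (ih i)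

theorem realize_var (s : L.Term α) :
    s.realize (fun i => (mk Γ (Term.var i) : V.Presented Γ)) = mk Γ s := by
  induction s with
  | var i => rfl
  | func f ts ih =>
    rw [Term.realize_func]
    exact mk_func f fun i => (exists_mk _).choose_spec.trans (ih i)

theorem mem : V.Mem (V.Presented Γ) := by
  intro p hp x
  choose w hw using fun i => exists_mk (x i)
  obtain rfl : (fun i => mk Γ (w i)) = x := funext hw
  rw [realize_mk, realize_mk, mk_eq_iff]
  refine ⟨∅, Set.empty_subset _, Set.finite_empty, fun A _ hA a _ => ?_⟩
  rw [Term.realize_subst, Term.realize_subst]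
  exact hA p hp _

theorem satisfies : Satisfies (fun i => (mk Γ (Term.var i) : V.Presented Γ)) Γ := by
  intro r hr
  rw [realize_var, realize_var, mk_eq_iff]
  exact ⟨{r}, Set.singleton_subset_iff.2 hr, Set.finite_singleton r, fun A _ _ a ha => ha r rfl⟩

/-- The homomorphism determined by an assignment that satisfies the relations. -/
def lift {B : Type u} [L.Structure B] (hB : V.Mem B) (h : α → B) (hh : Satisfies h Γ) :
    V.Presented Γ →[L] B where
  toFun := Quotient.lift (fun s => s.realize h) fun _ _ ⟨_, hs, _, he⟩ =>
    he B hB h fun r hr => hh r (hs hr)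
  map_fun' f x := by
    choose w hw using fun i => exists_mk (x i)
    obtain rfl : (fun i => mk Γ (w i)) = x := funext hw
    have hx : funMap f (fun i => (mk Γ (w i) : V.Presented Γ)) = mk Γ (Term.func f w) :=
      mk_func f fun i => (exists_mk _).choose_spec
    rw [hx]
    rfl
  map_rel' r _ := isEmptyElim r

theorem isFinitelyPresented {n : ℕ} {Γ : Set (L.Term (Fin n) × L.Term (Fin n))}
    (hΓ : Γ.Finite) : V.IsFinitelyPresented (V.Presented Γ) := by
  refine ⟨mem, n, Γ, fun i => mk Γ (Term.var i), hΓ, ?_, satisfies, ?_⟩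
  · rw [eq_top_iff]
    intro x _
    obtain ⟨s, rfl⟩ := exists_mk x
    exact (mem_closure_range_iff _ _).2 ⟨s, realize_var s⟩
  · exact fun B _ hB h hh => ⟨lift hB h hh, fun i => rfl⟩

end Presented

end Variety

end Presentation

/-! ### The term-defined order as an equation -/

section Order

variable {L : FirstOrder.Language.{u, v}}

theorem realize_iterTerm {A : Type u} [L.Structure A] (t : L.Term (Fin 1)) (k : ℕ)
    (x : Fin 1 → A) :
    (iterTerm t k).realize x = (fun a => t.realize fun _ => a)^[k] (x 0) := by
  induction k with
  | zero => rfl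
  | succ k ih =>
    rw [iterTerm, Term.realize_subst, Function.iterate_succ_apply']
    simp only [ih]

namespace SemilatticeOrderedVariety

variable (V : SemilatticeOrderedVariety L)

/-- The equation that expresses `s ≤ s'`. -/
def leEq {α : Type} (s s' : L.Term α) : L.Term α × L.Term α :=
  match V.kind with
  | .meet => (V.op.subst ![s, s'], s)
  | .join => (V.op.subst ![s, s'], s')

theorem realize_leEq {α : Type} {A : Type u} [L.Structure A] (h : α → A) (s s' : L.Term α) :
    (V.leEq s s').1.realize h = (V.leEq s s').2.realize h ↔
      V.le (s.realize h) (s'.realize h) := by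
  have : (fun i => (![s, s'] i).realize h) = ![s.realize h, s'.realize h] := by
    funext i
    fin_cases i <;> rfl
  unfold leEq le
  cases V.kind <;> simp only [Term.realize_subst, this]

theorem le_map {A B : Type u} [L.Structure A] [L.Structure B] (φ : A →[L] B) {x y : A}
    (h : V.le x y) : V.le (φ x) (φ y) := by
  have := (V.realize_leEq ![x, y] (Term.var 0) (Term.var 1)).2 h
  have := congrArg φ this
  rw [← HomClass.realize_term, ← HomClass.realize_term] at this
  exact (V.realize_leEq (φ ∘ ![x, y]) (Term.var 0) (Term.var 1)).1 this

variable {V} {t : L.Term (Fin 1)}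

theorem iterate_le_iterate (hdecr : V.IsDecreasing t) {A : Type u} [L.Structure A]
    (hA : V.Mem A) (a : A) {m n : ℕ} (h : m ≤ n) :
    V.le ((fun a => t.realize fun _ => a)^[n] a) ((fun a => t.realize fun _ => a)^[m] a) := by
  let := V.partialOrder hA
  refine antitone_nat_of_succ_le (f := fun k => (fun a : A => t.realize fun _ => a)^[k] a)
    (fun k => ?_) h
  rw [Function.iterate_succ_apply']
  exact hdecr A hA _

theorem fixpoint_le_iterate (hmono : V.IsOrderPreserving t) {A : Type u} [L.Structure A]
    (hA : V.Mem A) {a y : A} (hy : (t.realize fun _ => y) = y) (h : V.le y a) (k : ℕ) :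
    V.le y ((fun a => t.realize fun _ => a)^[k] a) := by
  induction k with
  | zero => exact h
  | succ k ih =>
    rw [Function.iterate_succ_apply']
    have := hmono A hA _ _ ih
    rwa [hy] at this

end SemilatticeOrderedVariety

end Order

/-! ### Canonical extensions -/

section Extensions

section Posets

variable {P C : Type u} [CompleteLattice C]

theorem isClosedElt_emb (e : P → C) (a : P) : IsClosedElt e (e a) :=
  ⟨{a}, Set.singleton_nonempty a, by simp⟩

theorem isOpenElt_emb (e : P → C) (a : P) : IsOpenElt e (e a) :=
  ⟨{a}, Set.singleton_nonempty a, by simp⟩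

variable [PartialOrder P] {e : P → C}

namespace IsCanonicalExtension

/-- Compactness for the meet of a decreasing sequence. -/
theorem exists_le_of_sInf_le (he : IsCanonicalExtension e) {c : ℕ → P} (hc : Antitone c) {a : P}
    (h : sInf (e '' Set.range c) ≤ e a) : ∃ n, c n ≤ a := by
  obtain ⟨A₀, hA₀, B₀, hB₀, hAf, -, hle⟩ := he.compact (e '' Set.range c) {e a}
    ((Set.range_nonempty c).image e) (Set.singleton_nonempty _)
    (by rintro _ ⟨b, -, rfl⟩; exact isClosedElt_emb e b)
    (by rintro _ rfl; exact isOpenElt_emb e a) (by rwa [sSup_singleton])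
  have hidx : ∀ d ∈ A₀, ∃ n, d = e (c n) := fun d hd => by
    obtain ⟨_, ⟨n, rfl⟩, rfl⟩ := hA₀ hd
    exact ⟨n, rfl⟩
  choose! idx hidx using hidx
  obtain ⟨N, hN⟩ := (hAf.image idx).bddAbove
  refine ⟨N, (he.le_iff _ _).1 ?_⟩
  calc e (c N) ≤ sInf A₀ := le_sInf fun d hd => by
        rw [hidx d hd, he.le_iff]
        exact hc (hN (Set.mem_image_of_mem idx hd))
    _ ≤ sSup B₀ := hle
    _ ≤ e a := sSup_le fun b hb => (hB₀ hb).le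

/-- The meet of a decreasing orbit of a monotone map `f` is below its image under `f^σ`. -/
theorem sInf_le_sigmaExt (he : IsCanonicalExtension e) {f : P → P} (hf : Monotone f) {c : ℕ → P}
    (hc : Antitone c) (hfc : ∀ n, f (c n) = c (n + 1)) :
    sInf (e '' Set.range c) ≤
      sigmaExt e (fun a : Fin 1 → P => f (a 0)) fun _ => sInf (e '' Set.range c) := by
  refine le_trans ?_ (le_sSup ⟨fun _ => sInf (e '' Set.range c), fun _ => e (c 0),
    fun _ => ⟨_, Set.range_nonempty c, rfl⟩, fun _ => isOpenElt_emb e _, le_rfl,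
    fun _ => sInf_le ⟨_, ⟨0, rfl⟩, rfl⟩, rfl⟩)
  refine le_sInf ?_
  rintro _ ⟨a, ha, rfl⟩
  obtain ⟨n, hn⟩ := he.exists_le_of_sInf_le hc (ha 0).1
  calc sInf (e '' Set.range c) ≤ e (c (n + 1)) := sInf_le ⟨_, ⟨n + 1, rfl⟩, rfl⟩
    _ ≤ e (f (a 0)) := by
      rw [he.le_iff, ← hfc]
      exact hf hn

end IsCanonicalExtension

theorem sigmaExt_emb {ι : Type*} (he : IsCanonicalExtension e) (f : (ι → P) → P) (a : ι → P) :
    sigmaExt e f (fun i => e (a i)) = e (f a) := by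
  apply le_antisymm
  · refine sSup_le ?_
    rintro _ ⟨p, q, -, -, hp, hq, rfl⟩
    exact sInf_le ⟨a, fun i => ⟨hp i, hq i⟩, rfl⟩
  · refine le_sSup ⟨fun i => e (a i), fun i => e (a i), fun i => isClosedElt_emb e _,
      fun i => isOpenElt_emb e _, le_rfl, le_rfl, le_antisymm (le_sInf ?_) (sInf_le ?_)⟩
    · rintro _ ⟨b, hb, rfl⟩
      obtain rfl : a = b := funext fun i =>
        le_antisymm ((he.le_iff _ _).1 (hb i).1) ((he.le_iff _ _).1 (hb i).2)
      exact le_rfl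
    · exact ⟨a, fun i => ⟨le_rfl, le_rfl⟩, rfl⟩

theorem piExt_emb {ι : Type*} (he : IsCanonicalExtension e) (f : (ι → P) → P) (a : ι → P) :
    piExt e f (fun i => e (a i)) = e (f a) := by
  apply le_antisymm
  · refine sInf_le ⟨fun i => e (a i), fun i => e (a i), fun i => isClosedElt_emb e _,
      fun i => isOpenElt_emb e _, le_rfl, le_rfl, le_antisymm (le_sSup ?_) (sSup_le ?_)⟩
    · exact ⟨a, fun i => ⟨le_rfl, le_rfl⟩, rfl⟩
    · rintro _ ⟨b, hb, rfl⟩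
      obtain rfl : a = b := funext fun i =>
        le_antisymm ((he.le_iff _ _).1 (hb i).1) ((he.le_iff _ _).1 (hb i).2)
      exact le_rfl
  · refine le_sInf ?_
    rintro _ ⟨p, q, -, -, hp, hq, rfl⟩
    exact le_sSup ⟨a, fun i => ⟨hp i, hq i⟩, rfl⟩

end Posets

namespace SemilatticeOrderedVariety.CanonicalExtensions

variable {L : FirstOrder.Language.{u, v}} {V : SemilatticeOrderedVariety L}
  (E : V.CanonicalExtensions) {A : Type u} [L.Structure A] (hA : V.Mem A)

theorem isCanonicalExtension_emb :
    @IsCanonicalExtension A (E.Ext hA) _ (V.partialOrder hA) (E.emb hA) :=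
  @CanonicalExtension.isCanonicalExtension A (V.partialOrder hA) (E A hA)

variable [L.IsAlgebraic]

/-- The embedding of `A` into `A^σ` as a homomorphism. -/
def embHom : A →[L] E.Ext hA where
  toFun := E.emb hA
  map_fun' {n} f x := by
    let := V.partialOrder hA
    have he := E.isCanonicalExtension_emb hA
    change _ = match V.extKind f with
      | .sigma => sigmaExt (E.emb hA) (fun a => funMap f a) fun i => E.emb hA (x i)
      | .pi => piExt (E.emb hA) (fun a => funMap f a) fun i => E.emb hA (x i)
    cases V.extKind f
    · exact (sigmaExt_emb he _ x).symm
    · exact (piExt_emb he _ x).symm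
  map_rel' r _ := isEmptyElim r

theorem embHom_injective : Function.Injective (E.embHom hA) := by
  let := V.partialOrder hA
  have he := E.isCanonicalExtension_emb hA
  exact fun a b h => le_antisymm ((he.le_iff a b).1 h.le) ((he.le_iff b a).1 h.ge)

/-- In `A^σ` the meet of the iterates of an expanding, monotone and decreasing term `t` at an
element of `A` is a fixpoint of `t`. -/
theorem realize_sInf_iterate (hclosed : V.ClosedUnderCanonicalExtensions E)
    {t : L.Term (Fin 1)} (hexp : V.IsExpanding E t)
    (hmono : V.IsOrderPreserving t) (hdecr : V.IsDecreasing t) (a : A) :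
    (t.realize fun _ =>
        sInf (E.emb hA '' Set.range fun k => (fun a => t.realize fun _ => a)^[k] a)) =
      sInf (E.emb hA '' Set.range fun k => (fun a => t.realize fun _ => a)^[k] a) := by
  let := V.partialOrder hA
  have he := E.isCanonicalExtension_emb hA
  obtain ⟨hmem, hle⟩ := hclosed A hA
  refine le_antisymm ((hle _ _).1 (hdecr _ hmem _)) (le_trans ?_ (hexp A hA _))
  have ht : (fun b : Fin 1 → A => t.realize b) = fun b => t.realize fun _ => b 0 := by
    funext b
    congr 1
    funext i
    rw [Subsingleton.elim i 0]
  rw [ht]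
  exact he.sInf_le_sigmaExt (f := fun a => t.realize fun _ => a) (fun x y h => hmono A hA x y h)
    (fun m n h => iterate_le_iterate hdecr hA a h)
    fun n => (Function.iterate_succ_apply' (fun a => t.realize fun _ => a) n a).symm

end SemilatticeOrderedVariety.CanonicalExtensions

end Extensions

/-! ### Fixpoints and iterates -/

namespace SemilatticeOrderedVariety

variable {L : FirstOrder.Language.{u, v}} (V : SemilatticeOrderedVariety L) (t : L.Term (Fin 1))

/-- The relations `z ≤ y`, `y ≤ x`, `t(y) ≈ y`, for `x, y, z` the variables `0, 1, 2`. -/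
def fixpointRelations : Set (L.Term (Fin 3) × L.Term (Fin 3)) :=
  {V.leEq (.var 2) (.var 1), V.leEq (.var 1) (.var 0), (t.subst fun _ => .var 1, .var 1)}

theorem satisfies_fixpointRelations_iff {A : Type u} [L.Structure A] (h : Fin 3 → A) :
    Satisfies h (V.fixpointRelations t) ↔
      V.le (h 2) (h 1) ∧ V.le (h 1) (h 0) ∧ (t.realize fun _ => h 1) = h 1 := by
  simp only [Satisfies, fixpointRelations, Set.forall_mem_insert, Set.mem_singleton_iff,
    forall_eq, realize_leEq, Term.realize_subst, Term.realize_var]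

/-- The relation `z ≤ tᵏ(x)`, for `x, z` the variables `0, 1`. -/
def iterateRelation (k : ℕ) : L.Term (Fin 2) × L.Term (Fin 2) :=
  V.leEq (.var 1) ((iterTerm t k).subst fun _ => .var 0)

theorem realize_iterateRelation {A : Type u} [L.Structure A] (h : Fin 2 → A) (k : ℕ) :
    (V.iterateRelation t k).1.realize h = (V.iterateRelation t k).2.realize h ↔
      V.le (h 1) ((fun a => t.realize fun _ => a)^[k] (h 0)) := by
  simp only [iterateRelation, realize_leEq, Term.realize_subst, Term.realize_var,
    realize_iterTerm]

variable {V t}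

/-- As the iterates of `t` decrease, finitely many of the relations `z ≤ tᵏ(x)` follow from any
single one of large index. -/
theorem exists_satisfies_of_finite (hdecr : V.IsDecreasing t)
    {Δ : Set (L.Term (Fin 2) × L.Term (Fin 2))} (hΔ : Δ ⊆ Set.range (V.iterateRelation t))
    (hf : Δ.Finite) :
    ∃ N, ∀ n, N ≤ n → ∀ (A : Type u) [L.Structure A], V.Mem A → ∀ h : Fin 2 → A,
      V.le (h 1) ((fun a => t.realize fun _ => a)^[n] (h 0)) → Satisfies h Δ := by
  choose! idx hidx using hΔ
  obtain ⟨N, hN⟩ := (hf.image idx).bddAbove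
  refine ⟨N, fun n hn A _ hA h hle r hr => ?_⟩
  rw [← hidx hr, realize_iterateRelation]
  let := V.partialOrder hA
  exact le_trans (α := A) hle
    (iterate_le_iterate hdecr hA _ ((hN (Set.mem_image_of_mem idx hr)).trans hn))

variable [L.IsAlgebraic]

/-- An equation between `x` and `z` that follows from the existence of a fixpoint of `t` between
them already follows from `z ≤ tᵏ(x)` for all `k`. -/
theorem mk_eq_of_entails (E : V.CanonicalExtensions)
    (hclosed : V.ClosedUnderCanonicalExtensions E) (hexp : V.IsExpanding E t)
    (hmono : V.IsOrderPreserving t) (hdecr : V.IsDecreasing t) {s s' : L.Term (Fin 2)}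
    (h : V.Entails (V.fixpointRelations t) (s.subst ![.var 0, .var 2])
      (s'.subst ![.var 0, .var 2])) :
    (Variety.Presented.mk (Set.range (V.iterateRelation t)) s : V.Presented _) =
      Variety.Presented.mk (Set.range (V.iterateRelation t)) s' := by
  set Γ := Set.range (V.iterateRelation t)
  have hQ : V.Mem (V.Presented Γ) := Variety.Presented.mem
  let g : Fin 2 → V.Presented Γ := fun i => Variety.Presented.mk Γ (.var i)
  obtain ⟨hmem, hle⟩ := hclosed _ hQ
  let c : ℕ → V.Presented Γ := fun k => (fun a => t.realize fun _ => a)^[k] (g 0)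
  have hgc (k : ℕ) : V.le (g 1) (c k) :=
    (V.realize_iterateRelation t g k).1 (Variety.Presented.satisfies _ ⟨k, rfl⟩)
  let m : E.Ext hQ := sInf (E.emb hQ '' Set.range c)
  let w : Fin 3 → E.Ext hQ := ![E.embHom hQ (g 0), m, E.embHom hQ (g 1)]
  have hw : Satisfies w (V.fixpointRelations t) := by
    rw [satisfies_fixpointRelations_iff]
    refine ⟨(hle _ _).2 (le_sInf ?_), (hle _ _).2 (sInf_le ⟨_, ⟨0, rfl⟩, rfl⟩),
      E.realize_sInf_iterate hQ hclosed hexp hmono hdecr (g 0)⟩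
    rintro _ ⟨_, ⟨k, rfl⟩, rfl⟩
    exact (hle _ _).1 (V.le_map (E.embHom hQ) (hgc k))
  have key := h _ hmem w hw
  have hcomp : (fun i => (![.var 0, .var 2] i : L.Term (Fin 3)).realize w) =
      E.embHom hQ ∘ g := by
    funext i
    fin_cases i <;> rfl
  rw [Term.realize_subst, Term.realize_subst, hcomp, HomClass.realize_term,
    HomClass.realize_term] at key
  have := E.embHom_injective hQ key
  rwa [Variety.Presented.realize_var, Variety.Presented.realize_var] at this

/-- By coherence the conditions `z ≤ tᵏ(x)`, for all `k`, amount to a single one of them. -/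
theorem exists_le_iterate_succ (hcoh : V.toVariety.Coherent)
    (E : V.CanonicalExtensions) (hclosed : V.ClosedUnderCanonicalExtensions E)
    (hexp : V.IsExpanding E t) (hmono : V.IsOrderPreserving t) (hdecr : V.IsDecreasing t) :
    ∃ N, ∀ (A : Type u) [L.Structure A], V.Mem A → ∀ x z : A,
      V.le z ((fun a => t.realize fun _ => a)^[N] x) →
        V.le z ((fun a => t.realize fun _ => a)^[N + 1] x) := by
  let P := V.Presented (V.fixpointRelations t)
  let γ : Fin 3 → P := fun i => Variety.Presented.mk _ (.var i)
  have hγ := (V.satisfies_fixpointRelations_iff t γ).1 Variety.Presented.satisfies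
  let gP : Fin 2 → P := ![γ 0, γ 2]
  let S : L.Substructure P := Substructure.closure L (Set.range gP)
  let gS : Fin 2 → S := fun i => ⟨gP i, Substructure.subset_closure ⟨i, rfl⟩⟩
  obtain ⟨hS, n, R, g, hR, hg, hgR, huniv⟩ := hcoh P
    (Variety.Presented.isFinitelyPresented (by simp [fixpointRelations]))
    S (Substructure.fg_closure (Set.finite_range gP))
  -- An equation that holds in `S` is a consequence of `z ≤ tⁿ(x)` for all large `n`.
  have hS_eq (s s' : L.Term (Fin 2)) (h : s.realize gS = s'.realize gS) :
      ∃ N, ∀ n, N ≤ n → ∀ (A : Type u) [L.Structure A], V.Mem A → ∀ h : Fin 2 → A,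
        V.le (h 1) ((fun a => t.realize fun _ => a)^[n] (h 0)) →
          s.realize h = s'.realize h := by
    have hP : s.realize gP = s'.realize gP := by
      have := congrArg S.subtype h
      rwa [← HomClass.realize_term, ← HomClass.realize_term] at this
    have hgP : gP = fun i => Variety.Presented.mk _ (![.var 0, .var 2] i) := by
      funext i
      fin_cases i <;> rfl
    rw [hgP, Variety.Presented.realize_mk, Variety.Presented.realize_mk,
      Variety.Presented.mk_eq_iff] at hP
    obtain ⟨Δ, hΔ, -, hent⟩ := hP
    obtain ⟨Δ', hΔ', hf', hent'⟩ := Variety.Presented.mk_eq_iff.1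
      (mk_eq_of_entails E hclosed hexp hmono hdecr (hent.mono hΔ))
    obtain ⟨N, hN⟩ := exists_satisfies_of_finite hdecr hΔ' hf'
    exact ⟨N, fun n hn A _ hA h hle => hent' A hA h (hN n hn A hA h hle)⟩
  -- Each of the two generating tuples of `S` is expressed by terms in the other one.
  have hw (i : Fin n) : ∃ s : L.Term (Fin 2), s.realize gS = g i := by
    obtain ⟨s, hs⟩ := (mem_closure_range_iff gP _).1 (g i).2
    refine ⟨s, Subtype.ext ?_⟩
    rw [← hs]
    exact (HomClass.realize_term S.subtype (t := s) (v := gS)).symm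
  choose w hw using hw
  have hu (j : Fin 2) : ∃ s : L.Term (Fin n), s.realize g = gS j :=
    (mem_closure_range_iff g _).1 (hg ▸ Substructure.mem_top (gS j))
  choose u hu using hu
  have hR_eq (r : R) := hS_eq (r.1.1.subst w) (r.1.2.subst w) (by
    simp only [Term.realize_subst, hw]
    exact hgR r r.2)
  have hu_eq (j : Fin 2) := hS_eq ((u j).subst w) (.var j) (by
    simp only [Term.realize_subst, hw]
    exact hu j)
  choose N₁ hN₁ using hR_eq
  choose N₂ hN₂ using hu_eq
  have := hR.to_subtype
  obtain ⟨M₁, hM₁⟩ := (Set.finite_range N₁).bddAbove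
  obtain ⟨M₂, hM₂⟩ := (Set.finite_range N₂).bddAbove
  refine ⟨max M₁ M₂, fun A _ hA x z hle => ?_⟩
  obtain ⟨φ, hφ⟩ := huniv A hA (fun i => (w i).realize ![x, z]) fun r hr => by
    have := hN₁ ⟨r, hr⟩ _ ((hM₁ ⟨⟨r, hr⟩, rfl⟩).trans (le_max_left M₁ M₂)) A hA ![x, z] hle
    rwa [Term.realize_subst, Term.realize_subst] at this
  have hφS (j : Fin 2) : φ (gS j) = ![x, z] j := by
    have := hN₂ j _ ((hM₂ ⟨j, rfl⟩).trans (le_max_right M₁ M₂)) A hA ![x, z] hle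
    rw [← hu j, ← HomClass.realize_term, show φ ∘ g = _ from funext hφ, ← Term.realize_subst,
      this]
    rfl
  -- In `S` all the inequalities `z ≤ tᵏ(x)` hold, because of the fixpoint `y` in `P`.
  have hk (k : ℕ) : (V.iterateRelation t k).1.realize gS =
      (V.iterateRelation t k).2.realize gS := by
    apply Subtype.ext
    have h := (V.realize_iterateRelation t gP k).2 (by
      let := V.partialOrder (A := P) Variety.Presented.mem
      exact le_trans (α := P) hγ.1
        (fixpoint_le_iterate hmono Variety.Presented.mem hγ.2.2 hγ.2.1 k))
    rw [← show S.subtype ∘ gS = gP from rfl, HomClass.realize_term, HomClass.realize_term] at h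
    exact h
  have := congrArg φ (hk (max M₁ M₂ + 1))
  rw [← HomClass.realize_term, ← HomClass.realize_term, show φ ∘ gS = _ from funext hφS] at this
  exact (V.realize_iterateRelation t ![x, z] _).1 this

end SemilatticeOrderedVariety

end CanonExt

theorem theorem5p1 {L : FirstOrder.Language.{u, v}} [L.IsAlgebraic] [Nonempty L.Constants]
    (V : CanonExt.SemilatticeOrderedVariety L) (hcoh : V.toVariety.Coherent)
    (E : V.CanonicalExtensions) (hclosed : V.ClosedUnderCanonicalExtensions E)
    (t : L.Term (Fin 1)) (hexp : V.IsExpanding E t)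
    (hmono : V.IsOrderPreserving t) (hdecr : V.IsDecreasing t) :
    ∃ n : ℕ, V.toVariety.IsPotent n t := by
  obtain ⟨N, hN⟩ := CanonExt.SemilatticeOrderedVariety.exists_le_iterate_succ hcoh E hclosed
    hexp hmono hdecr
  refine ⟨N, fun A _ hA x => ?_⟩
  let := V.partialOrder hA
  rw [CanonExt.realize_iterTerm, CanonExt.realize_iterTerm]
  exact le_antisymm (α := A)
    (CanonExt.SemilatticeOrderedVariety.iterate_le_iterate hdecr hA _ N.le_succ)
    (hN A hA _ _ (le_refl (α := A) _))
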